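/- Average output SNR of shadowing-based UAV selection under double shadowing. Let $L\ge 1$, $m_1,m_2>0$, $\Omega>0$, $\overline\gamma_1,\overline\gamma_2>0$, $\alpha_1>1$ with $2\alpha_1\in\mathbb N$, and $\alpha_2=\alpha_1+\tfrac12$. For $1\le i\le L$ and $j\in\{1,2\}$ let $N_{i,j}$ and $I_{i,j}$ be $4L$ mutually independent random variables such that $N_{i,j}^2$ has density $\frac{m_j^{m_j}x^{m_j-1}}{\Omega^{m_j}\Gamma(m_j)}e^{-m_jx/\Omega}$, $x>0$ (the square of a Nakagami-$m_j$ variable with mean square $\Omega$), and $I_{i,j}$ has the inverse gamma density $\frac{\overline\gamma_j^{\alpha_j}}{\Gamma(\alpha_j)y^{\alpha_j+1}}e^{-\overline\gamma_j/y}$, $y>0$. Put $N_i=(N_{i,1}N_{i,2})^2$, $I_i=I_{i,1}I_{i,2}$, $\overline\gamma=\Omega^2\,\overline\gamma_1\overline\gamma_2$ (so $\overline\gamma=\overline\gamma_1\overline\gamma_2$ in the normalization $\Omega=1$), and let $\gamma_{\rm out}=N_{i^*}\max_{1\le i\le L}I_i$, where $i^*$ is a (random, measurable) index with $I_{i^*}=\max_{1\le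 i\le L} I_i$ almost surely. Then $\gamma_{\rm out}$ is integrable and has a density $f_{\gamma_{\rm out}}$, and its mean $\overline\gamma_{\rm out}=\mathbb E[\gamma_{\rm out}]=\int_0^\infty x f_{\gamma_{\rm out}}(x)\,dx$ (a convergent integral) is $$\overline\gamma_{\rm out}=\frac{L}{\Gamma(\alpha_1)\Gamma(\alpha_2)}\sum_{i_1=0}^{L-1}\sum_{i_2=0}^{i_1}\binom{L-1}{i_1}\binom{i_1}{i_2}\sum_{\substack{n_0,\dots,n_{2\alpha_1-1}\ge 0\\ n_0+\cdots+n_{2\alpha_1-1}=i_2}}\frac{\mathcal A\,\overline\gamma\,2^{7/2-q}\sqrt\pi\,\Gamma(q-5/2)}{(i_2+1)^{q-5/2}},$$ where $\mathcal A=\frac{i_2!}{n_0!\,n_1!\cdots n_{2\alpha_1-1}!}\prod_{j=1}^{2\alpha_1-1}\left(\frac{2^j}{j!}\right)^{n_j}(-1)^{i_1+i_2}$ and $q=\alpha_1+\alpha_2+\sum_{j=1}^{2\alpha_1-1}j\,n_j$. In particular $\overline\gamma_{\rm out}$ does not depend on the Nakagami parameters $m_1,m_2$: two such systems, possibly on different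 probability spaces, with the same $L,\Omega,\alpha_1,\alpha_2,\overline\gamma_1,\overline\gamma_2$ but different $m_1,m_2$ have the same average output SNR. -/

import Mathlib

open MeasureTheory ProbabilityTheory Set
open scoped BigOperators Nat

noncomputable section

namespace UAVSelection

/-- Density of the inverse gamma distribution with shape `a` and scale `b`. -/
def invGammaPDFReal (a b y : ℝ) : ℝ :=
  if 0 < y then b ^ a / (Real.Gamma a * y ^ (a + 1)) * Real.exp (-(b / y)) else 0

/-- The inverse gamma distribution with shape `a` and scale `b`. -/
def invGammaMeasure (a b : ℝ) : Measure ℝ :=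
  volume.withDensity (fun y => ENNReal.ofReal (invGammaPDFReal a b y))

/-- The double-shadowing channel with `L` UAVs and two scattering regions (indexed by `Fin 2`).
`N i j` is the multipath fading coefficient and `S i j` the shadowing coefficient of the `j`-th
region of the `i`-th UAV. All these variables are independent. The square `(N i j) ^ 2` of a
Nakagami variable with shape `m j` and mean square `Ω` has the gamma law with shape `m j` and rate
`m j / Ω`, and `S i j` has the inverse gamma law with shape `α j` and scale `γ j`. -/
structure IsDoubleShadowing {W : Type*} [MeasurableSpace W] (P : Measure W) (L : ℕ)
    (m : Fin 2 → ℝ) (Ω : ℝ) (α γ : Fin 2 → ℝ) (N S : Fin L → Fin 2 → W → ℝ) : Prop where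
  measurable_fading : ∀ i j, Measurable (N i j)
  measurable_shadowing : ∀ i j, Measurable (S i j)
  law_fading : ∀ i j, HasLaw (fun w => N i j w ^ 2) (gammaMeasure (m j) (m j / Ω)) P
  law_shadowing : ∀ i j, HasLaw (S i j) (invGammaMeasure (α j) (γ j)) P
  indep : iIndepFun
    (Sum.elim (fun p : Fin L × Fin 2 => N p.1 p.2) (fun p : Fin L × Fin 2 => S p.1 p.2)) P

/-- Total multipath fading `N_i = (N_{i,1} N_{i,2})²` of the `i`-th UAV. -/
def totalFading {W : Type*} {L : ℕ} (N : Fin L → Fin 2 → W → ℝ) (i : Fin L) (w : W) : ℝ :=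
  (N i 0 w * N i 1 w) ^ 2

/-- Total shadowing `I_i = I_{i,1} I_{i,2}` of the `i`-th UAV. -/
def totalShadowing {W : Type*} {L : ℕ} (S : Fin L → Fin 2 → W → ℝ) (i : Fin L) (w : W) : ℝ :=
  S i 0 w * S i 1 w

/-- `sel` is (the index of) a UAV whose total shadowing variable is the largest one. -/
structure IsShadowingSelection {W : Type*} [MeasurableSpace W] (P : Measure W) {L : ℕ}
    (S : Fin L → Fin 2 → W → ℝ) (sel : W → Fin L) : Prop where
  measurable_sel : Measurable sel
  maximal : ∀ᵐ w ∂P, ∀ i, totalShadowing S i w ≤ totalShadowing S (sel w) w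

/-- Output SNR: the multipath fading of the selected UAV times the largest shadowing variable. -/
def outputSNR {W : Type*} {L : ℕ} (N S : Fin L → Fin 2 → W → ℝ) (sel : W → Fin L) (w : W) : ℝ :=
  totalFading N (sel w) w * ⨆ i, totalShadowing S i w

/-- Average SNR `∫₀^∞ x f_X(x) dx` of a random variable `X` with density `f_X`. -/
def averageSNR {W : Type*} [MeasurableSpace W] (P : Measure W) (X : W → ℝ) : ℝ :=
  ∫ x in Ioi (0 : ℝ), x * (pdf X P volume x).toReal

/-- The coefficient `𝒜`; here `k` is the number of the summation indices `n_0, …, n_{k-1}`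
(the factor with `j = 0` is equal to `1`). -/
def coeffA {k : ℕ} (i₁ i₂ : ℕ) (n : Fin k → ℕ) : ℝ :=
  (i₂ ! : ℝ) / (∏ j, ((n j)! : ℝ)) *
    (∏ j : Fin k, ((2 : ℝ) ^ (j : ℕ) / ((j : ℕ)! : ℝ)) ^ n j) * (-1) ^ (i₁ + i₂)

/-- The exponent `q = α₁ + α₂ + ∑ j n_j`. -/
def expoQ {k : ℕ} (α : Fin 2 → ℝ) (n : Fin k → ℕ) : ℝ :=
  α 0 + α 1 + ∑ j : Fin k, ((j : ℕ) : ℝ) * (n j : ℝ)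

/-- The closed form of the average output SNR. The inner sum is over all
`(n_0, …, n_{k-1})` in `{0, …, i₂}^k` with `n_0 + ⋯ + n_{k-1} = i₂`. -/
def closedFormASNR (L k : ℕ) (α : Fin 2 → ℝ) (gbar : ℝ) : ℝ :=
  (L : ℝ) / (Real.Gamma (α 0) * Real.Gamma (α 1)) *
    ∑ i₁ ∈ Finset.range L, ∑ i₂ ∈ Finset.range (i₁ + 1),
      ((L - 1).choose i₁ : ℝ) * (i₁.choose i₂ : ℝ) *
        ∑ n ∈ (Finset.univ : Finset (Fin k)).piAntidiag i₂,
          coeffA i₁ i₂ n * gbar * (2 : ℝ) ^ (7 / 2 - expoQ α n) * √Real.pi *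
            Real.Gamma (expoQ α n - 5 / 2) / ((i₂ : ℝ) + 1) ^ (expoQ α n - 5 / 2)

end UAVSelection

end

/-! The duplication formula for Γ collapses the double shadowing to a single gamma variable. If X
and Y are independent inverse gamma variables with shapes a and a + 1/2 and scales b and c, then XY
has the law of 4bc/U² with U of gamma law of shape 2a and rate 1: the characteristic functions of
the logarithms agree (`map_log_add_log_eq`, `hasLaw_sqrt_div_mul`). The largest shadowing thus
corresponds to the smallest of L i.i.d. gamma variables of integer shape k = 2α₁, whose survival
function is the finite sum exp(-u) ∑_{j<k} u^j/j!.

Ties are null, so the output is almost surely ∑ᵢ Nᵢ Iᵢ 1{Iᵢ is largest}. Fading is independent of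
all the shadowing, so each term has mean E[Nᵢ] E[Iᵢ 1{Iᵢ is largest}]. The first factor is Ω²,
whatever the Nakagami shapes. By Fubini, the second is γ₁γ₂ ∫ 4/u² · P(U ≥ u)^(L-1) against the
gamma law of shape k, which is finite since k > 2. Binomial and multinomial expansions reduce this
to Gamma integrals and give the closed form (`closedFormASNR_eq_integral`).

The output has a density because it always equals one of the L products NᵢIᵢ, each of which has an
absolutely continuous law. -/

namespace UAVSelection

/-! ### Gamma and inverse gamma laws and their Mellin transforms -/

section GammaLaw

theorem measurable_gammaPDF (a r : ℝ) : Measurable (gammaPDF a r) :=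
  (measurable_gammaPDFReal a r).ennreal_ofReal

theorem integral_gammaMeasure {E : Type*} [NormedAddCommGroup E] [NormedSpace ℝ E] {a r : ℝ}
    (ha : 0 < a) (hr : 0 < r) (f : ℝ → E) :
    ∫ x, f x ∂gammaMeasure a r =
      ∫ x in Ioi 0, (r ^ a / Real.Gamma a * x ^ (a - 1) * Real.exp (-(r * x))) • f x := by
  rw [gammaMeasure, integral_withDensity_eq_integral_toReal_smul
    (measurable_gammaPDF a r) (by simp [gammaPDF]),
    ← integral_Ici_eq_integral_Ioi, ← integral_indicator measurableSet_Ici]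
  refine integral_congr_ae (ae_of_all _ fun x => ?_)
  simp only [gammaPDF, ENNReal.toReal_ofReal (gammaPDFReal_nonneg ha hr x), indicator, mem_Ici]
  by_cases hx : 0 ≤ x <;> simp [gammaPDFReal, hx]

theorem integrable_gammaMeasure_iff {a r : ℝ} (ha : 0 < a) (hr : 0 < r) (f : ℝ → ℝ) :
    Integrable f (gammaMeasure a r) ↔
      IntegrableOn (fun x => r ^ a / Real.Gamma a * x ^ (a - 1) * Real.exp (-(r * x)) * f x)
        (Ioi 0) := by
  rw [gammaMeasure, integrable_withDensity_iff_integrable_smul'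
    (measurable_gammaPDF a r) (by simp [gammaPDF]),
    ← integrableOn_Ici_iff_integrableOn_Ioi, ← integrable_indicator_iff measurableSet_Ici]
  refine integrable_congr (ae_of_all _ fun x => ?_)
  simp only [gammaPDF, ENNReal.toReal_ofReal (gammaPDFReal_nonneg ha hr x), indicator, mem_Ici]
  by_cases hx : 0 ≤ x <;> simp [gammaPDFReal, hx]

theorem integrableOn_rpow_mul_exp_neg_mul {s b : ℝ} (hs : 0 < s) (hb : 0 < b) :
    IntegrableOn (fun x : ℝ => x ^ (s - 1) * Real.exp (-(b * x))) (Ioi 0) := by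
  simpa [neg_mul] using integrableOn_rpow_mul_exp_neg_mul_rpow (s := s - 1) (p := 1) (b := b)
    (by linarith) one_pos hb

theorem invGammaMeasure_absolutelyContinuous (a r : ℝ) : invGammaMeasure a r ≪ volume :=
  withDensity_absolutelyContinuous _ _

theorem ae_pos_gammaMeasure (a r : ℝ) : ∀ᵐ x ∂gammaMeasure a r, 0 < x := by
  rw [gammaMeasure, ae_withDensity_iff (measurable_gammaPDF a r)]
  have h0 : ∀ᵐ x : ℝ, x ≠ 0 := by simp [ae_iff]
  filter_upwards [h0] with x hx h
  by_contra hneg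
  exact h (gammaPDF_of_neg (lt_of_le_of_ne (not_lt.1 hneg) hx))

theorem measurable_invGammaPDFReal (a b : ℝ) : Measurable (invGammaPDFReal a b) := by
  unfold invGammaPDFReal
  exact Measurable.ite measurableSet_Ioi (by fun_prop) measurable_const

theorem invGammaPDFReal_nonneg {a b : ℝ} (ha : 0 < a) (hb : 0 < b) (y : ℝ) :
    0 ≤ invGammaPDFReal a b y := by
  unfold invGammaPDFReal
  split_ifs <;> positivity

theorem ae_pos_invGammaMeasure (a b : ℝ) : ∀ᵐ x ∂invGammaMeasure a b, 0 < x := by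
  rw [invGammaMeasure, ae_withDensity_iff (measurable_invGammaPDFReal a b).ennreal_ofReal]
  refine ae_of_all _ fun x h => ?_
  by_contra hneg
  exact h (by simp [invGammaPDFReal, hneg])

/-- The Mellin transform of the gamma distribution. -/
theorem integral_exp_mul_log_gammaMeasure {a r : ℝ} (ha : 0 < a) (hr : 0 < r) {s : ℂ}
    (hs : 0 < a + s.re) :
    ∫ x, Complex.exp (s * Real.log x) ∂gammaMeasure a r =
      Complex.exp (-s * Real.log r) * Complex.Gamma (a + s) / Real.Gamma a := by
  have hr' : (r : ℂ) ≠ 0 := by exact_mod_cast hr.ne'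
  have key : ∀ x ∈ Ioi (0 : ℝ), (r ^ a / Real.Gamma a * x ^ (a - 1) * Real.exp (-(r * x))) •
      Complex.exp (s * Real.log x) = ((r ^ a / Real.Gamma a : ℝ) : ℂ) *
        ((x : ℂ) ^ ((a + s : ℂ) - 1) * Complex.exp (-(r * x))) := by
    intro x hx
    have hx' : (0 : ℝ) < x := hx
    have hx0 : (x : ℂ) ≠ 0 := by exact_mod_cast hx'.ne'
    rw [show ((a : ℂ) + s) - 1 = ((a - 1 : ℝ) : ℂ) + s by push_cast; ring,
      Complex.cpow_add _ _ hx0, ← Complex.ofReal_cpow hx'.le, Complex.cpow_def_of_ne_zero hx0,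
      ← Complex.ofReal_log hx'.le, Complex.real_smul, mul_comm (Real.log x : ℂ) s]
    push_cast
    ring
  rw [integral_gammaMeasure ha hr, setIntegral_congr_fun measurableSet_Ioi key,
    integral_const_mul, Complex.integral_cpow_mul_exp_neg_mul_Ioi (by simpa using hs) hr,
    one_div, Complex.cpow_add _ _ (inv_ne_zero hr'), ← Complex.ofReal_inv,
    ← Complex.ofReal_cpow (by positivity), Complex.cpow_def_of_ne_zero (by simpa using hr'),
    ← Complex.ofReal_log (by positivity), Real.log_inv, Real.inv_rpow hr.le]
  have hG : (Real.Gamma a : ℂ) ≠ 0 := by exact_mod_cast (Real.Gamma_pos_of_pos ha).ne'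
  have hp : ((r ^ a : ℝ) : ℂ) ≠ 0 := by exact_mod_cast (Real.rpow_pos_of_pos hr a).ne'
  push_cast
  rw [show -(Real.log r : ℂ) * s = -s * Real.log r by ring]
  field_simp

/-- The Mellin transform of the inverse gamma distribution. -/
theorem integral_exp_mul_log_invGammaMeasure {a b : ℝ} (ha : 0 < a) (hb : 0 < b) {s : ℂ}
    (hs : s.re < a) :
    ∫ x, Complex.exp (s * Real.log x) ∂invGammaMeasure a b =
      Complex.exp (s * Real.log b) * Complex.Gamma (a - s) / Real.Gamma a := by
  -- The substitution x ↦ 1/x turns the inverse gamma density into the gamma density with rate b and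
  -- changes the sign of s.
  have hsub : ∫ x, Complex.exp (s * Real.log x) ∂invGammaMeasure a b =
      ∫ x, Complex.exp (-s * Real.log x) ∂gammaMeasure a b := by
    rw [invGammaMeasure, integral_withDensity_eq_integral_toReal_smul
      (measurable_invGammaPDFReal a b).ennreal_ofReal (by simp)]
    have h1 : ∫ x, (ENNReal.ofReal (invGammaPDFReal a b x)).toReal •
        Complex.exp (s * Real.log x) = ∫ x in Ioi (0 : ℝ),
          (b ^ a / (Real.Gamma a * x ^ (a + 1)) * Real.exp (-(b / x))) •
            Complex.exp (s * Real.log x) := by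
      rw [← integral_indicator measurableSet_Ioi]
      refine integral_congr_ae (ae_of_all _ fun x => ?_)
      simp only [ENNReal.toReal_ofReal (invGammaPDFReal_nonneg ha hb x), indicator, mem_Ioi]
      by_cases hx : 0 < x <;> simp [invGammaPDFReal, hx]
    rw [h1, integral_gammaMeasure ha hb,
      ← integral_comp_rpow_Ioi _ (show (-1 : ℝ) ≠ 0 by norm_num)]
    refine setIntegral_congr_fun measurableSet_Ioi fun x hx => ?_
    have hx' : (0 : ℝ) < x := hx
    simp only [Real.rpow_neg_one, Real.log_inv, smul_smul]
    rw [show ((-1 : ℝ) - 1) = -2 by norm_num, Real.inv_rpow hx'.le, Real.rpow_neg hx'.le,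
      show a + 1 = (a - 1) + 2 by ring, Real.rpow_add hx']
    have h2 : 0 < x ^ (2 : ℝ) := Real.rpow_pos_of_pos hx' _
    have h3 : 0 < x ^ (a - 1) := Real.rpow_pos_of_pos hx' _
    have hG := Real.Gamma_pos_of_pos ha
    have h4 : |(-1 : ℝ)| = 1 := by norm_num
    have h5 : s * ((-Real.log x : ℝ) : ℂ) = -s * Real.log x := by push_cast; ring
    rw [h4, h5, div_inv_eq_mul]
    congr 1
    field_simp
  rw [hsub, integral_exp_mul_log_gammaMeasure ha hb (by simpa using hs), neg_neg, sub_eq_add_neg]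

end GammaLaw

/-! ### Product of two inverse gamma variables via the duplication formula -/

section Duplication

variable {W : Type*} [MeasurableSpace W] {P : Measure W}

theorem charFun_map_log_of_hasLaw_invGamma {X : W → ℝ} {a b : ℝ} (ha : 0 < a) (hb : 0 < b)
    (hX : HasLaw X (invGammaMeasure a b) P) (t : ℝ) :
    charFun (P.map (fun w => Real.log (X w))) t =
      Complex.exp (t * Complex.I * Real.log b) * Complex.Gamma (a - t * Complex.I) /
        Real.Gamma a := by
  have h : P.map (fun w => Real.log (X w)) = (invGammaMeasure a b).map Real.log := by
    rw [← hX.map_eq, AEMeasurable.map_map_of_aemeasurable (by fun_prop) hX.aemeasurable]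
    rfl
  rw [h, charFun_apply_real, integral_map (by fun_prop) (by fun_prop),
    ← integral_exp_mul_log_invGammaMeasure ha hb (by simpa using ha)]
  congr 1 with x
  congr 1
  ring

/-- By the duplication formula, the logarithm of a product of independent inverse gamma variables
whose shapes differ by `1 / 2` is an affine function of the logarithm of a gamma variable. -/
theorem map_log_add_log_eq [IsProbabilityMeasure P] {X Y : W → ℝ} {a b c : ℝ} (ha : 0 < a)
    (hb : 0 < b) (hc : 0 < c) (hX : HasLaw X (invGammaMeasure a b) P)
    (hY : HasLaw Y (invGammaMeasure (a + 1 / 2) c) P) (hXY : IndepFun X Y P) :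
    P.map (fun w => Real.log (X w) + Real.log (Y w)) =
      (gammaMeasure (2 * a) 1).map (fun u => Real.log (4 * (b * c)) - 2 * Real.log u) := by
  have h2a : 0 < 2 * a := by positivity
  have := isProbabilityMeasure_gammaMeasure h2a one_pos
  have hXm := hX.aemeasurable
  have hYm := hY.aemeasurable
  refine Measure.ext_of_charFun (funext fun t => ?_)
  have hind : IndepFun (fun w => Real.log (X w)) (fun w => Real.log (Y w)) P :=
    hXY.comp Real.measurable_log Real.measurable_log
  rw [hind.charFun_map_fun_add_eq_mul (by fun_prop) (by fun_prop), Pi.mul_apply,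
    charFun_map_log_of_hasLaw_invGamma ha hb hX,
    charFun_map_log_of_hasLaw_invGamma (by positivity) hc hY, charFun_apply_real,
    integral_map (by fun_prop) (by fun_prop)]
  have hexp : ∀ u : ℝ, Complex.exp (t * ((Real.log (4 * (b * c)) - 2 * Real.log u : ℝ) : ℂ) *
      Complex.I) = Complex.exp (t * Complex.I * Real.log (4 * (b * c))) *
        Complex.exp ((-2 * (t * Complex.I)) * Real.log u) := by
    intro u
    rw [← Complex.exp_add]
    congr 1
    push_cast
    ring
  simp_rw [hexp]
  rw [integral_const_mul, integral_exp_mul_log_gammaMeasure h2a one_pos (by simpa using ha)]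
  -- Duplication is used at a - it for the numerators and at a for the normalizing constants. The
  -- quotient of the two powers of 2 is exp(it log 4), the source of the factor 4 in the affine map.
  have hd1 := Complex.Gamma_mul_Gamma_add_half (a - t * Complex.I)
  have hd2 := Real.Gamma_mul_Gamma_add_half_of_pos ha
  have hG1 := Real.Gamma_pos_of_pos ha
  have hG2 := Real.Gamma_pos_of_pos (show 0 < a + 1 / 2 by positivity)
  have hG3 := Real.Gamma_pos_of_pos h2a
  have hpow : (2 : ℂ) ^ (1 - 2 * (a - t * Complex.I)) =
      ((2 ^ (1 - 2 * a) : ℝ) : ℂ) * Complex.exp (t * Complex.I * Real.log 4) := by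
    rw [show (1 : ℂ) - 2 * (a - t * Complex.I) = ((1 - 2 * a : ℝ) : ℂ) + 2 * (t * Complex.I) by
      push_cast; ring, Complex.cpow_add _ _ two_ne_zero, Complex.ofReal_cpow (by norm_num)]
    congr 1
    rw [Complex.cpow_def_of_ne_zero two_ne_zero, show (4 : ℝ) = 2 ^ 2 by norm_num, Real.log_pow]
    congr 1
    rw [show Complex.log 2 = ((Real.log 2 : ℝ) : ℂ) by
      rw [Complex.ofReal_log (by norm_num)]; simp]
    push_cast
    ring
  have hlog : Complex.exp (t * Complex.I * Real.log (4 * (b * c))) =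
      Complex.exp (t * Complex.I * Real.log 4) * Complex.exp (t * Complex.I * Real.log b) *
        Complex.exp (t * Complex.I * Real.log c) := by
    rw [Real.log_mul (by norm_num) (by positivity), Real.log_mul hb.ne' hc.ne',
      ← Complex.exp_add, ← Complex.exp_add]
    congr 1
    push_cast
    ring
  rw [hpow] at hd1
  have hd2' := congrArg (fun x : ℝ => (x : ℂ)) hd2
  simp only [Complex.ofReal_mul] at hd2'
  have e1 : (((a + 1 / 2 : ℝ) : ℂ) - t * Complex.I) = a - t * Complex.I + 1 / 2 := by
    push_cast; ring
  have e2 : (((2 * a : ℝ) : ℂ) + -2 * (t * Complex.I)) = 2 * (a - t * Complex.I) := by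
    push_cast; ring
  rw [hlog, e1, e2, Real.log_one, Complex.ofReal_zero, mul_zero, Complex.exp_zero, one_mul,
    div_mul_div_comm, hd2',
    show ∀ A B C D : ℂ, A * B * (C * D) = A * C * (B * D) from fun A B C D => by ring, hd1]
  have h1 : (Real.Gamma (2 * a) : ℂ) ≠ 0 := by exact_mod_cast hG3.ne'
  have h2 : ((2 ^ (1 - 2 * a) : ℝ) : ℂ) ≠ 0 := by
    exact_mod_cast (Real.rpow_pos_of_pos two_pos _).ne'
  have h3 : ((√Real.pi : ℝ) : ℂ) ≠ 0 := by
    exact_mod_cast (Real.sqrt_pos.2 Real.pi_pos).ne'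
  field_simp

/-- Solving XY = 4bc/U² for U. The resulting function decreases in XY, so it exchanges maxima and
minima. -/
theorem hasLaw_sqrt_div_mul [IsProbabilityMeasure P] {X Y : W → ℝ} {a b c : ℝ} (ha : 0 < a)
    (hb : 0 < b) (hc : 0 < c) (hX : HasLaw X (invGammaMeasure a b) P)
    (hY : HasLaw Y (invGammaMeasure (a + 1 / 2) c) P) (hXY : IndepFun X Y P) :
    HasLaw (fun w => 2 * √(b * c / (X w * Y w))) (gammaMeasure (2 * a) 1) P := by
  have hXm := hX.aemeasurable
  have hYm := hY.aemeasurable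
  refine ⟨by fun_prop, ?_⟩
  have hXp : ∀ᵐ w ∂P, 0 < X w :=
    ae_of_ae_map hXm (by rw [hX.map_eq]; exact ae_pos_invGammaMeasure _ _)
  have hYp : ∀ᵐ w ∂P, 0 < Y w :=
    ae_of_ae_map hYm (by rw [hY.map_eq]; exact ae_pos_invGammaMeasure _ _)
  have hg : Measurable fun x : ℝ => 2 * √(b * c / Real.exp x) := by fun_prop
  have h1 : P.map (fun w => 2 * √(b * c / (X w * Y w))) =
      (P.map (fun w => Real.log (X w) + Real.log (Y w))).map
        (fun x => 2 * √(b * c / Real.exp x)) := by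
    rw [AEMeasurable.map_map_of_aemeasurable (by fun_prop) (by fun_prop)]
    refine Measure.map_congr ?_
    filter_upwards [hXp, hYp] with w hx hy
    simp [Real.exp_add, Real.exp_log hx, Real.exp_log hy]
  rw [h1, map_log_add_log_eq ha hb hc hX hY hXY, Measure.map_map hg (by fun_prop)]
  -- With the gamma law written as its own image under the identity, it is enough that the composite
  -- of the two maps fixes almost every u, namely every u > 0.
  conv_rhs => rw [← Measure.map_id (μ := gammaMeasure (2 * a) 1)]
  refine Measure.map_congr ?_
  filter_upwards [ae_pos_gammaMeasure (2 * a) 1] with u hu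
  have : b * c / Real.exp (Real.log (4 * (b * c)) - 2 * Real.log u) = (u / 2) ^ 2 := by
    rw [Real.exp_sub, Real.exp_log (by positivity), mul_comm 2, Real.exp_mul, Real.exp_log hu]
    norm_cast
    field_simp
    norm_num
  simp only [Function.comp_apply, id]
  rw [this, Real.sqrt_sq (by positivity)]
  ring

end Duplication

/-! ### Survival function of a gamma law of integer shape -/

section Survival

/-- The derivative telescopes: only the top term survives, which is the gamma density of shape k + 1
and rate 1. -/
theorem hasDerivAt_exp_neg_mul_sum (k : ℕ) (x : ℝ) :
    HasDerivAt (fun x : ℝ => -(Real.exp (-x) * ∑ j ∈ Finset.range (k + 1), x ^ j / (j ! : ℝ)))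
      (x ^ k / (k ! : ℝ) * Real.exp (-x)) x := by
  have hexp : HasDerivAt (fun x : ℝ => Real.exp (-x)) (-Real.exp (-x)) x := by
    simpa using (hasDerivAt_neg x).exp
  induction k with
  | zero => simpa using hexp.fun_neg
  | succ k ih =>
    have hpow : HasDerivAt (fun x : ℝ => x ^ (k + 1) / ((k + 1)! : ℝ)) (x ^ k / (k ! : ℝ)) x := by
      convert! (hasDerivAt_pow (k + 1) x).div_const ((k + 1)! : ℝ) using 1
      rw [Nat.factorial_succ]
      push_cast
      field_simp
    have := ih.sub (hexp.mul hpow)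
    convert! this using 1
    · ext y
      simp only [Pi.sub_apply, Pi.mul_apply]
      rw [Finset.sum_range_succ _ (k + 1)]
      ring
    · ring

/-- The survival function of a gamma variable of integer shape. -/
theorem gammaMeasure_real_Ici (k : ℕ) {u : ℝ} (hu : 0 ≤ u) :
    (gammaMeasure ((k + 1 : ℕ) : ℝ) 1).real (Ici u) =
      Real.exp (-u) * ∑ j ∈ Finset.range (k + 1), u ^ j / (j ! : ℝ) := by
  have hk : (0 : ℝ) < ((k + 1 : ℕ) : ℝ) := by positivity
  have hG : Real.Gamma ((k + 1 : ℕ) : ℝ) = k ! := by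
    push_cast; exact Real.Gamma_nat_eq_factorial k
  have hdens : ∀ x : ℝ, (1 : ℝ) ^ ((k + 1 : ℕ) : ℝ) / Real.Gamma ((k + 1 : ℕ) : ℝ) *
      x ^ (((k + 1 : ℕ) : ℝ) - 1) * Real.exp (-(1 * x)) = x ^ k / (k ! : ℝ) * Real.exp (-x) := by
    intro x
    rw [hG, Real.one_rpow, show (((k + 1 : ℕ) : ℝ) - 1) = (k : ℝ) by push_cast; ring,
      Real.rpow_natCast, one_mul]
    ring
  -- Integrability of the density is read off from the finiteness of the total mass.
  have hint : IntegrableOn (fun x : ℝ => x ^ k / (k ! : ℝ) * Real.exp (-x)) (Ioi 0) := by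
    have := isProbabilityMeasure_gammaMeasure hk one_pos
    have h1 : Integrable (fun _ : ℝ => (1 : ℝ)) (gammaMeasure ((k + 1 : ℕ) : ℝ) 1) :=
      integrable_const 1
    rw [integrable_gammaMeasure_iff hk one_pos] at h1
    simpa only [hdens, mul_one] using h1
  have htend : Filter.Tendsto
      (fun x : ℝ => -(Real.exp (-x) * ∑ j ∈ Finset.range (k + 1), x ^ j / (j ! : ℝ)))
      Filter.atTop (nhds 0) := by
    have : Filter.Tendsto
        (fun x : ℝ => ∑ j ∈ Finset.range (k + 1), x ^ j * Real.exp (-x) / (j ! : ℝ))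
        Filter.atTop (nhds (∑ j ∈ Finset.range (k + 1), 0 / (j ! : ℝ))) :=
      tendsto_finsetSum _ fun j _ =>
        (Real.tendsto_pow_mul_exp_neg_atTop_nhds_zero j).div_const _
    simp only [zero_div, Finset.sum_const_zero] at this
    convert! this.neg using 1
    · ext x
      rw [Finset.mul_sum]
      congr 1
      exact Finset.sum_congr rfl fun j _ => by ring
    · simp
  rw [← integral_indicator_one measurableSet_Ici, integral_gammaMeasure hk one_pos]
  simp_rw [hdens]
  have hi : ∀ x : ℝ, (x ^ k / (k ! : ℝ) * Real.exp (-x)) • (Ici u).indicator (1 : ℝ → ℝ) x =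
      (Ici u).indicator (fun x => x ^ k / (k ! : ℝ) * Real.exp (-x)) x := by
    intro x
    by_cases hx : x ∈ Ici u <;> simp [hx]
  simp_rw [hi]
  rw [← integral_Ici_eq_integral_Ioi, setIntegral_indicator measurableSet_Ici,
    inter_eq_right.2 (Ici_subset_Ici.2 hu), integral_Ici_eq_integral_Ioi,
    integral_Ioi_of_hasDerivAt_of_tendsto' (fun x _ => hasDerivAt_exp_neg_mul_sum k x)
      (hint.mono_set (Ioi_subset_Ioi hu)) htend]
  ring

end Survival

/-! ### The minimum of i.i.d. variables -/

section ProductMeasure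

/-- Integrating a function of the smallest among i.i.d. variables, on the event that it is the
`i`-th one. -/
theorem integrable_and_integral_pi_indicator_forall_le {n : ℕ} (ν : Measure ℝ)
    [IsProbabilityMeasure ν] (i : Fin (n + 1)) {f : ℝ → ℝ} (hf : Integrable f ν) :
    Integrable (fun x : Fin (n + 1) → ℝ => {x | ∀ j, x i ≤ x j}.indicator (fun x => f (x i)) x)
      (Measure.pi fun _ => ν) ∧
    ∫ x : Fin (n + 1) → ℝ, {x | ∀ j, x i ≤ x j}.indicator (fun x => f (x i)) x
      ∂(Measure.pi fun _ => ν) = ∫ u, f u * ν.real (Ici u) ^ n ∂ν := by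
  let h : ℝ × (Fin n → ℝ) → ℝ := {p | ∀ j, p.1 ≤ p.2 j}.indicator (fun p => f p.1)
  -- Splitting off the i-th coordinate leaves n conditions, the one at j = i being trivial. For
  -- fixed u they cut out a box of mass ν [u, ∞) ^ n.
  have hmp := measurePreserving_piFinSuccAbove (fun _ : Fin (n + 1) => ν) i
  have hcomp : (fun x : Fin (n + 1) → ℝ => {x | ∀ j, x i ≤ x j}.indicator (fun x => f (x i)) x) =
      h ∘ MeasurableEquiv.piFinSuccAbove (fun _ => ℝ) i := by
    ext x
    simp only [h, Function.comp_apply, indicator, mem_ofPred_eq]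
    congr 1
    simp [Fin.forall_iff_succAbove i, Fin.removeNth]
  have hmeas : MeasurableSet {p : ℝ × (Fin n → ℝ) | ∀ j, p.1 ≤ p.2 j} := by
    simp only [ofPred_forall]
    exact MeasurableSet.iInter fun j => measurableSet_le (by fun_prop) (by fun_prop)
  have hint : Integrable h (ν.prod (Measure.pi fun _ => ν)) :=
    (hf.comp_fst (Measure.pi fun _ : Fin n => ν)).indicator hmeas
  rw [hcomp]
  refine ⟨(hmp.integrable_comp_emb (MeasurableEquiv.measurableEmbedding _)).2 hint, ?_⟩
  refine (hmp.integral_comp (MeasurableEquiv.measurableEmbedding _) h).trans ?_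
  rw [integral_prod _ hint]
  congr 1 with u
  have hset : {y : Fin n → ℝ | ∀ j, u ≤ y j} = univ.pi fun _ => Ici u := by
    ext y; simp [Pi.le_def]
  have hin : ∀ y : Fin n → ℝ, h (u, y) = {y : Fin n → ℝ | ∀ j, u ≤ y j}.indicator
      (fun _ => f u) y := fun y => rfl
  simp_rw [hin]
  rw [hset, integral_indicator_const _ (MeasurableSet.univ_pi fun _ => measurableSet_Ici),
    measureReal_def, Measure.pi_pi]
  simp [measureReal_def, mul_comm]

end ProductMeasure

/-! ### Expansion into the closed form -/

section ClosedForm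

/-- Expand ((Q - 1) + 1)^n, then each (Q - 1)^i₁. This redundant rewriting of Q^n produces the two
outer sums of the closed form; the sign uses that i₁ - i₂ and i₁ + i₂ have the same parity. -/
theorem pow_eq_sum_choose_mul_choose (Q : ℝ) (n : ℕ) :
    Q ^ n = ∑ i₁ ∈ Finset.range (n + 1), ∑ i₂ ∈ Finset.range (i₁ + 1),
      (n.choose i₁ : ℝ) * (i₁.choose i₂ : ℝ) * ((-1) ^ (i₁ + i₂) * Q ^ i₂) := by
  have h := add_pow (Q + -1) 1 n
  rw [neg_add_cancel_right] at h
  rw [h]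
  refine Finset.sum_congr rfl fun i _ => ?_
  rw [add_pow Q (-1) i, one_pow, mul_one, Finset.sum_mul]
  refine Finset.sum_congr rfl fun j hj => ?_
  obtain ⟨d, rfl⟩ := Nat.exists_eq_add_of_le (Finset.mem_range_succ_iff.1 hj)
  rw [Nat.add_sub_cancel_left, show j + d + j = 2 * j + d by ring, pow_add (-1 : ℝ) (2 * j),
    pow_mul]
  norm_num
  ring

/-- Multinomial expansion of a power of the survival function of a gamma variable. -/
theorem exp_neg_mul_sum_pow (k i : ℕ) (u : ℝ) :
    (Real.exp (-u) * ∑ j ∈ Finset.range k, u ^ j / (j ! : ℝ)) ^ i =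
      ∑ n ∈ (Finset.univ : Finset (Fin k)).piAntidiag i,
        ((Nat.multinomial Finset.univ n : ℝ) * ∏ j : Fin k, (1 / ((j : ℕ)! : ℝ)) ^ n j) *
          (u ^ (∑ j : Fin k, (j : ℕ) * n j) * Real.exp (-(i * u))) := by
  rw [mul_pow, ← Fin.sum_univ_eq_sum_range (fun j => u ^ j / (j ! : ℝ)),
    Finset.sum_pow_eq_sum_piAntidiag, Finset.mul_sum]
  refine Finset.sum_congr rfl fun n _ => ?_
  rw [← Finset.prod_pow_eq_pow_sum, ← Real.exp_nat_mul, show (i : ℝ) * -u = -(i * u) by ring]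
  have : ∏ j : Fin k, (u ^ (j : ℕ) / ((j : ℕ)! : ℝ)) ^ n j =
      (∏ j : Fin k, (1 / ((j : ℕ)! : ℝ)) ^ n j) * ∏ j : Fin k, u ^ ((j : ℕ) * n j) := by
    rw [← Finset.prod_mul_distrib]
    refine Finset.prod_congr rfl fun j _ => ?_
    rw [pow_mul, ← mul_pow]
    congr 1
    ring
  rw [this]
  ring

/-- Against the gamma density, the weight 4/u² · u^p lowers the shape k to k - 2 + p, still positive
as k ≥ 3, and the exponential raises the rate from 1 to i + 1. -/
theorem integrable_and_integral_inv_sq_mul_pow {k : ℕ} (hk : 3 ≤ k) (p i : ℕ) :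
    Integrable (fun u => 4 / u ^ 2 * (u ^ p * Real.exp (-(i * u)))) (gammaMeasure k 1) ∧
    ∫ u, 4 / u ^ 2 * (u ^ p * Real.exp (-(i * u))) ∂gammaMeasure k 1 =
      4 / Real.Gamma k * (Real.Gamma ((k : ℝ) - 2 + p) / ((i : ℝ) + 1) ^ ((k : ℝ) - 2 + p)) := by
  have hk' : (3 : ℝ) ≤ k := by exact_mod_cast hk
  have hk0 : (0 : ℝ) < k := by linarith
  have hs : 0 < (k : ℝ) - 2 + p := by have : (0 : ℝ) ≤ p := by positivity
                                      linarith
  have hi : (0 : ℝ) < (i : ℝ) + 1 := by positivity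
  have key : EqOn (fun u : ℝ => (1 : ℝ) ^ (k : ℝ) / Real.Gamma k * u ^ ((k : ℝ) - 1) *
        Real.exp (-(1 * u)) * (4 / u ^ 2 * (u ^ p * Real.exp (-(i * u)))))
      (fun u => 4 / Real.Gamma k * (u ^ (((k : ℝ) - 2 + p) - 1) *
        Real.exp (-(((i : ℝ) + 1) * u)))) (Ioi 0) := by
    intro u hu
    have hu' : (0 : ℝ) < u := hu
    simp only
    rw [show ((k : ℝ) - 2 + p) - 1 = ((k : ℝ) - 1) + p - 2 by ring,
      Real.rpow_sub hu' _ 2, Real.rpow_add hu' _ (p : ℝ), Real.rpow_natCast u p, Real.rpow_two,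
      Real.one_rpow,
      show -(((i : ℝ) + 1) * u) = -(1 * u) + -(i * u) by ring, Real.exp_add]
    ring
  constructor
  · rw [integrable_gammaMeasure_iff hk0 one_pos, integrableOn_congr_fun key measurableSet_Ioi]
    exact (integrableOn_rpow_mul_exp_neg_mul hs hi).const_mul _
  · rw [integral_gammaMeasure hk0 one_pos]
    simp only [smul_eq_mul]
    rw [setIntegral_congr_fun measurableSet_Ioi key, integral_const_mul,
      Real.integral_rpow_mul_exp_neg_mul_Ioi hs hi, Real.div_rpow zero_le_one hi.le,
      Real.one_rpow]
    ring

theorem integrable_inv_sq_gammaMeasure {k : ℕ} (hk : 3 ≤ k) :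
    Integrable (fun u : ℝ => 4 / u ^ 2) (gammaMeasure k 1) := by
  simpa using (integrable_and_integral_inv_sq_mul_pow hk 0 0).1

theorem integrable_and_integral_inv_sq_mul_survival_pow {k : ℕ} (hk : 3 ≤ k) (i : ℕ) :
    Integrable (fun u => 4 / u ^ 2 * (gammaMeasure k 1).real (Ici u) ^ i) (gammaMeasure k 1) ∧
    ∫ u, 4 / u ^ 2 * (gammaMeasure k 1).real (Ici u) ^ i ∂gammaMeasure k 1 =
      ∑ n ∈ (Finset.univ : Finset (Fin k)).piAntidiag i,
        ((Nat.multinomial Finset.univ n : ℝ) * ∏ j : Fin k, (1 / ((j : ℕ)! : ℝ)) ^ n j) *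
          (4 / Real.Gamma k * (Real.Gamma ((k : ℝ) - 2 + (∑ j : Fin k, (j : ℕ) * n j : ℕ)) /
            ((i : ℝ) + 1) ^ ((k : ℝ) - 2 + (∑ j : Fin k, (j : ℕ) * n j : ℕ)))) := by
  have hae : (fun u => 4 / u ^ 2 * (gammaMeasure k 1).real (Ici u) ^ i) =ᵐ[gammaMeasure k 1]
      fun u => ∑ n ∈ (Finset.univ : Finset (Fin k)).piAntidiag i,
        ((Nat.multinomial Finset.univ n : ℝ) * ∏ j : Fin k, (1 / ((j : ℕ)! : ℝ)) ^ n j) *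
          (4 / u ^ 2 * (u ^ (∑ j : Fin k, (j : ℕ) * n j) * Real.exp (-(i * u)))) := by
    filter_upwards [ae_pos_gammaMeasure k 1] with u hu
    obtain ⟨k, rfl⟩ : ∃ k', k = k' + 1 := ⟨k - 1, by omega⟩
    rw [gammaMeasure_real_Ici k hu.le, exp_neg_mul_sum_pow, Finset.mul_sum]
    exact Finset.sum_congr rfl fun n _ => by ring
  have hint := fun n : Fin k → ℕ =>
    integrable_and_integral_inv_sq_mul_pow hk (∑ j : Fin k, (j : ℕ) * n j) i
  refine ⟨(integrable_congr hae).2 (integrable_finsetSum _ fun n _ => (hint n).1.const_mul _), ?_⟩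
  rw [integral_congr_ae hae, integral_finsetSum _ fun n _ => (hint n).1.const_mul _]
  exact Finset.sum_congr rfl fun n _ => by rw [integral_const_mul, (hint n).2]

/-- Both sides agree term by term. Duplication turns Γ(α₁)Γ(α₂) into Γ(k) 2^(1-k) √π; then √π
cancels, and so do all powers of 2 except the factor 4 of 4/u². -/
theorem closedFormASNR_eq_integral {n k : ℕ} {α : Fin 2 → ℝ} (hk3 : 3 ≤ k)
    (hk : (k : ℝ) = 2 * α 0) (hα : α 1 = α 0 + 1 / 2) (g : ℝ) :
    closedFormASNR (n + 1) k α g =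
      g * (((n + 1 : ℕ) : ℝ) * ∫ u, 4 / u ^ 2 * (gammaMeasure k 1).real (Ici u) ^ n
        ∂gammaMeasure k 1) := by
  have hk0 : (0 : ℝ) < k := by exact_mod_cast (by omega : 0 < k)
  have hα0 : 0 < α 0 := by linarith
  have hI := fun i => integrable_and_integral_inv_sq_mul_survival_pow hk3 i
  have hexpand : ∫ u, 4 / u ^ 2 * (gammaMeasure k 1).real (Ici u) ^ n ∂gammaMeasure k 1 =
      ∑ i₁ ∈ Finset.range (n + 1), ∑ i₂ ∈ Finset.range (i₁ + 1),
        (n.choose i₁ : ℝ) * (i₁.choose i₂ : ℝ) * (-1) ^ (i₁ + i₂) *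
          ∫ u, 4 / u ^ 2 * (gammaMeasure k 1).real (Ici u) ^ i₂ ∂gammaMeasure k 1 := by
    have : ∀ u, 4 / u ^ 2 * (gammaMeasure k 1).real (Ici u) ^ n =
        ∑ i₁ ∈ Finset.range (n + 1), ∑ i₂ ∈ Finset.range (i₁ + 1),
          (n.choose i₁ : ℝ) * (i₁.choose i₂ : ℝ) * (-1) ^ (i₁ + i₂) *
            (4 / u ^ 2 * (gammaMeasure k 1).real (Ici u) ^ i₂) := by
      intro u
      rw [pow_eq_sum_choose_mul_choose _ n, Finset.mul_sum]
      refine Finset.sum_congr rfl fun i _ => ?_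
      rw [Finset.mul_sum]
      exact Finset.sum_congr rfl fun j _ => by ring
    simp_rw [this]
    rw [integral_finsetSum _ fun i _ => integrable_finsetSum _ fun j _ => (hI j).1.const_mul _]
    refine Finset.sum_congr rfl fun i _ => ?_
    rw [integral_finsetSum _ fun j _ => (hI j).1.const_mul _]
    exact Finset.sum_congr rfl fun j _ => integral_const_mul _ _
  rw [hexpand, closedFormASNR, Nat.add_sub_cancel, Finset.mul_sum, Finset.mul_sum, Finset.mul_sum]
  refine Finset.sum_congr rfl fun i₁ _ => ?_
  rw [Finset.mul_sum, Finset.mul_sum, Finset.mul_sum]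
  refine Finset.sum_congr rfl fun i₂ _ => ?_
  rw [(hI i₂).2, Finset.mul_sum, Finset.mul_sum, Finset.mul_sum, Finset.mul_sum, Finset.mul_sum]
  refine Finset.sum_congr rfl fun m hm => ?_
  have hsum : ∑ j, m j = i₂ := by simpa using hm
  have hmult : (i₂ ! : ℝ) / (∏ j, ((m j)! : ℝ)) = Nat.multinomial Finset.univ m := by
    have h := Nat.multinomial_spec Finset.univ m
    rw [hsum] at h
    rw [← h]
    have : (∏ j, ((m j)! : ℝ)) ≠ 0 :=
      Finset.prod_ne_zero_iff.2 fun j _ => by exact_mod_cast (Nat.factorial_pos _).ne'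
    push_cast
    field_simp
  have hprod : ∏ j : Fin k, ((2 : ℝ) ^ (j : ℕ) / ((j : ℕ)! : ℝ)) ^ m j =
      2 ^ (∑ j : Fin k, (j : ℕ) * m j) * ∏ j : Fin k, (1 / ((j : ℕ)! : ℝ)) ^ m j := by
    rw [← Finset.prod_pow_eq_pow_sum, ← Finset.prod_mul_distrib]
    refine Finset.prod_congr rfl fun j _ => ?_
    rw [pow_mul, ← mul_pow]
    congr 1
    ring
  -- Since α₁ + α₂ = k + 1/2, the shift by 5/2 leaves the shape k - 2 plus the degree of the
  -- monomial.
  have hq : expoQ α m - 5 / 2 = (k : ℝ) - 2 + (∑ j : Fin k, (j : ℕ) * m j : ℕ) := by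
    rw [expoQ, hk, hα]
    push_cast
    ring
  have hq' : 7 / 2 - expoQ α m = 2 + (1 - (k : ℝ)) - (∑ j : Fin k, (j : ℕ) * m j : ℕ) := by
    linarith
  have hΓ := Real.Gamma_mul_Gamma_add_half_of_pos hα0
  rw [← hα, ← hk] at hΓ
  have hΓk := Real.Gamma_pos_of_pos hk0
  have h2 : (0 : ℝ) < 2 ^ (1 - (k : ℝ)) := Real.rpow_pos_of_pos two_pos _
  have hπ := Real.sqrt_pos.2 Real.pi_pos
  rw [coeffA, hmult, hprod, hq, hq', Real.rpow_sub two_pos, Real.rpow_add two_pos,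
    Real.rpow_natCast, hΓ, Real.rpow_two]
  have h3 : (0 : ℝ) < ((i₂ : ℝ) + 1) ^ ((k : ℝ) - 2 + (∑ j : Fin k, (j : ℕ) * m j : ℕ)) :=
    Real.rpow_pos_of_pos (by positivity) _
  generalize ((i₂ : ℝ) + 1) ^ ((k : ℝ) - 2 + (∑ j : Fin k, (j : ℕ) * m j : ℕ)) = D at *
  generalize ∏ j : Fin k, (1 / ((j : ℕ)! : ℝ)) ^ m j = B at *
  generalize Real.Gamma ((k : ℝ) - 2 + (∑ j : Fin k, (j : ℕ) * m j : ℕ)) = G at *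
  field_simp
  ring

end ClosedForm

/-! ### Null sets and grouping for independent variables -/

section Independence

variable {W : Type*} [MeasurableSpace W] {P : Measure W} [IsProbabilityMeasure P]

/-- Fubini: for fixed y ≠ 0, the preimage of a null set under multiplication by y is null. -/
theorem map_mul_absolutelyContinuous {X Y : W → ℝ} (hX : Measurable X) (hY : Measurable Y)
    (hXY : IndepFun X Y P) (hac : P.map X ≪ volume) (hY0 : ∀ᵐ w ∂P, Y w ≠ 0) :
    P.map (fun w => X w * Y w) ≪ volume := by
  refine Measure.AbsolutelyContinuous.mk fun s hs h0 => ?_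
  have hm : MeasurableSet {p : ℝ × ℝ | p.1 * p.2 ∈ s} := measurable_mul hs
  have hmap : P.map (fun w => X w * Y w) s =
      (P.map fun w => (Y w, X w)) {p : ℝ × ℝ | p.1 * p.2 ∈ s} := by
    rw [Measure.map_apply (by fun_prop) hs, Measure.map_apply (by fun_prop) hm]
    congr 1
    ext w
    simp [mul_comm]
  rw [hmap, (indepFun_iff_map_prod_eq_prod_map_map hY.aemeasurable hX.aemeasurable).1 hXY.symm,
    Measure.measure_prod_null hm]
  have hY0' : ∀ᵐ y ∂P.map Y, y ≠ 0 := by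
    exact (ae_map_iff hY.aemeasurable (measurableSet_singleton (0 : ℝ)).compl).2 hY0
  filter_upwards [hY0'] with y hy
  refine hac ?_
  change volume ((y * ·) ⁻¹' s) = 0
  rw [Real.volume_preimage_mul_left hy, h0, mul_zero]

/-- The diagonal is null for the product law, because its sections are single points and the law of
Y has no atoms. -/
theorem ae_ne_of_indepFun {X Y : W → ℝ} (hX : AEMeasurable X P) (hY : AEMeasurable Y P)
    (hXY : IndepFun X Y P) (hac : P.map Y ≪ volume) : ∀ᵐ w ∂P, X w ≠ Y w := by
  have hm : MeasurableSet {p : ℝ × ℝ | p.1 = p.2} :=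
    measurableSet_eq_fun measurable_fst measurable_snd
  have h : (P.map fun w => (X w, Y w)) {p : ℝ × ℝ | p.1 = p.2} = 0 := by
    rw [(indepFun_iff_map_prod_eq_prod_map_map hX hY).1 hXY, Measure.measure_prod_null hm]
    refine ae_of_all _ fun x => hac ?_
    have : Prod.mk x ⁻¹' {p : ℝ × ℝ | p.1 = p.2} = {x} := by
      ext y; simp [eq_comm]
    rw [this, measure_singleton]
  rw [Measure.map_apply_of_aemeasurable (hX.prodMk hY) hm] at h
  rw [ae_iff]
  simpa using h

/-- The joint law is a product over ι × κ; currying it gives a product over ι of products over κ. -/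
theorem iIndepFun_curry {ι κ : Type*} [Fintype ι] [Fintype κ] {X : ι → κ → W → ℝ}
    (hm : ∀ i j, Measurable (X i j)) (h : iIndepFun (fun p : ι × κ => X p.1 p.2) P) :
    iIndepFun (fun i w j => X i j w) P := by
  have hprob : ∀ i j, IsProbabilityMeasure (P.map (X i j)) :=
    fun i j => Measure.isProbabilityMeasure_map (hm i j).aemeasurable
  rw [iIndepFun_iff_map_fun_eq_infinitePi_map (fun i => measurable_pi_lambda _ fun j => hm i j)]
  have h1 := (iIndepFun_iff_map_fun_eq_infinitePi_map
    (fun p : ι × κ => hm p.1 p.2)).1 h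
  have h2 : ∀ i, P.map (fun w j => X i j w) = Measure.infinitePi fun j => P.map (X i j) :=
    fun i => (iIndepFun_iff_map_fun_eq_infinitePi_map (hm i)).1
      (h.precomp (g := fun j => (i, j)) fun a b hab => (Prod.mk.inj hab).2)
  simp_rw [h2]
  rw [← Measure.infinitePi_map_curry fun i j => P.map (X i j), ← h1]
  exact (Measure.map_map (g := MeasurableEquiv.curry ι κ ℝ) (MeasurableEquiv.measurable _)
    (measurable_pi_lambda (fun w (p : ι × κ) => X p.1 p.2 w) fun p => hm p.1 p.2)).symm

end Independence

/-! ### Means of gamma variables and means computed from densities -/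

section Moments

theorem integrable_and_integral_id_gammaMeasure {a r : ℝ} (ha : 0 < a) (hr : 0 < r) :
    Integrable (fun x => x) (gammaMeasure a r) ∧ ∫ x, x ∂gammaMeasure a r = a / r := by
  have key : EqOn (fun x : ℝ => r ^ a / Real.Gamma a * x ^ (a - 1) * Real.exp (-(r * x)) * x)
      (fun x => r ^ a / Real.Gamma a * (x ^ ((a + 1) - 1) * Real.exp (-(r * x)))) (Ioi 0) := by
    intro x hx
    have hx' : (0 : ℝ) < x := hx
    simp only
    rw [show (a + 1) - 1 = (a - 1) + 1 by ring, Real.rpow_add_one hx'.ne']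
    ring
  constructor
  · rw [integrable_gammaMeasure_iff ha hr, integrableOn_congr_fun key measurableSet_Ioi]
    exact (integrableOn_rpow_mul_exp_neg_mul (by positivity) hr).const_mul _
  · rw [integral_gammaMeasure ha hr]
    simp only [smul_eq_mul]
    rw [setIntegral_congr_fun measurableSet_Ioi key, integral_const_mul,
      Real.integral_rpow_mul_exp_neg_mul_Ioi (by positivity) hr, Real.Gamma_add_one ha.ne',
      Real.rpow_add_one (by positivity), one_div, Real.inv_rpow hr.le]
    have := Real.Gamma_pos_of_pos ha
    have := Real.rpow_pos_of_pos hr a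
    field_simp

/-- The mean of a nonnegative variable as an integral against its density on `(0, ∞)`. -/
theorem averageSNR_eq_integral {W : Type*} [MeasurableSpace W] {P : Measure W}
    [IsProbabilityMeasure P] {X : W → ℝ} [HasPDF X P volume] (hX : ∀ᵐ w ∂P, 0 ≤ X w) :
    averageSNR P X = ∫ w, X w ∂P := by
  -- The indicator restricts the density integral to (0, ∞) and costs nothing on the other side: X
  -- is almost surely nonnegative, and the value 0 contributes nothing.
  have h : ∫ x, (pdf X P volume x).toReal • (Ioi (0 : ℝ)).indicator id x =
      ∫ w, (Ioi (0 : ℝ)).indicator id (X w) ∂P :=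
    pdf.integral_pdf_smul (measurable_id.indicator measurableSet_Ioi).aestronglyMeasurable
  have h2 : ∫ w, (Ioi (0 : ℝ)).indicator id (X w) ∂P = ∫ w, X w ∂P := by
    refine integral_congr_ae ?_
    filter_upwards [hX] with w hw
    rcases hw.eq_or_lt with h0 | h0
    · simp [← h0]
    · simp [h0]
  rw [averageSNR, ← h2, ← h, ← integral_indicator measurableSet_Ioi]
  refine integral_congr_ae (ae_of_all _ fun x => ?_)
  by_cases hx : x ∈ Ioi (0 : ℝ) <;> simp [hx, mul_comm]

end Moments

theorem IsShadowingSelection.outputSNR_ae_eq_mul {W : Type*} [MeasurableSpace W] {P : Measure W}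
    {L : ℕ} {N S : Fin L → Fin 2 → W → ℝ} {sel : W → Fin L}
    (hsel : IsShadowingSelection P S sel) :
    outputSNR N S sel =ᵐ[P] fun w => totalFading N (sel w) w * totalShadowing S (sel w) w := by
  filter_upwards [hsel.maximal] with w hw
  have : Nonempty (Fin L) := ⟨sel w⟩
  rw [outputSNR, le_antisymm (ciSup_le hw)
    (le_ciSup (f := fun i => totalShadowing S i w) (finite_range _).bddAbove (sel w))]

/-! ### The double-shadowing channel -/

namespace IsDoubleShadowing

variable {W : Type*} [MeasurableSpace W] {P : Measure W} {L : ℕ}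
  {m : Fin 2 → ℝ} {Ω : ℝ} {α γ : Fin 2 → ℝ} {N S : Fin L → Fin 2 → W → ℝ}

section Basic

variable (h : IsDoubleShadowing P L m Ω α γ N S)
include h

theorem measurable_family (x : Fin L × Fin 2 ⊕ Fin L × Fin 2) :
    Measurable (Sum.elim (fun p : Fin L × Fin 2 => N p.1 p.2)
      (fun p : Fin L × Fin 2 => S p.1 p.2) x) := by
  rcases x with p | p
  · exact h.measurable_fading p.1 p.2
  · exact h.measurable_shadowing p.1 p.2

theorem iIndepFun_shadowing : iIndepFun (fun p : Fin L × Fin 2 => S p.1 p.2) P :=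
  h.indep.precomp Sum.inr_injective

theorem ae_shadowing_pos : ∀ᵐ w ∂P, ∀ i j, 0 < S i j w := by
  refine ae_all_iff.2 fun i => ae_all_iff.2 fun j => ?_
  exact ae_of_ae_map (h.law_shadowing i j).aemeasurable
    (by rw [(h.law_shadowing i j).map_eq]; exact ae_pos_invGammaMeasure _ _)

theorem ae_fading_ne_zero : ∀ᵐ w ∂P, ∀ i j, N i j w ≠ 0 := by
  refine ae_all_iff.2 fun i => ae_all_iff.2 fun j => ?_
  have := ae_of_ae_map (h.law_fading i j).aemeasurable
    (by rw [(h.law_fading i j).map_eq]; exact ae_pos_gammaMeasure _ _)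
  filter_upwards [this] with w hw h0
  simp [h0] at hw

theorem measurable_totalFading (i : Fin L) : Measurable (totalFading N i) :=
  ((h.measurable_fading i 0).mul (h.measurable_fading i 1)).pow_const 2

theorem measurable_totalShadowing (i : Fin L) : Measurable (totalShadowing S i) :=
  (h.measurable_shadowing i 0).mul (h.measurable_shadowing i 1)

theorem measurableSet_largest (i : Fin L) :
    MeasurableSet {w | ∀ j, totalShadowing S j w ≤ totalShadowing S i w} := by
  simp only [ofPred_forall]
  exact MeasurableSet.iInter fun j =>
    measurableSet_le (h.measurable_totalShadowing j) (h.measurable_totalShadowing i)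

/-- Independence from the whole shadowing array is needed, since the event that one UAV has the
largest shadowing involves all of them. -/
theorem indepFun_totalFading_shadowing (i : Fin L) :
    IndepFun (totalFading N i) (fun w i j => S i j w) P := by
  classical
  let A : Finset (Fin L × Fin 2 ⊕ Fin L × Fin 2) := {Sum.inl (i, 0), Sum.inl (i, 1)}
  let B : Finset (Fin L × Fin 2 ⊕ Fin L × Fin 2) := Finset.univ.map Function.Embedding.inr
  have hAB : Disjoint A B := by
    rw [Finset.disjoint_left]
    simp [A, B]
  have hB : ∀ p : Fin L × Fin 2, (Sum.inr p : Fin L × Fin 2 ⊕ Fin L × Fin 2) ∈ B := by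
    simp [B]
  exact (h.indep.indepFun_finset A B hAB h.measurable_family).comp
    (show Measurable fun x : A → ℝ =>
      (x ⟨Sum.inl (i, 0), by simp [A]⟩ * x ⟨Sum.inl (i, 1), by simp [A]⟩) ^ 2 by fun_prop)
    (show Measurable fun (y : B → ℝ) (i : Fin L) (j : Fin 2) =>
      y ⟨Sum.inr (i, j), hB (i, j)⟩ by fun_prop)

/-- Regroups NᵢIᵢ as one shadowing factor, which has a density, times an independent factor that is
almost surely nonzero. -/
theorem indepFun_shadowing_mul (i : Fin L) :
    IndepFun (S i 0) (fun w => S i 1 w * totalFading N i w) P := by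
  classical
  let A : Finset (Fin L × Fin 2 ⊕ Fin L × Fin 2) := {Sum.inr (i, 0)}
  let B : Finset (Fin L × Fin 2 ⊕ Fin L × Fin 2) :=
    {Sum.inl (i, 0), Sum.inl (i, 1), Sum.inr (i, 1)}
  have hAB : Disjoint A B := by
    rw [Finset.disjoint_left]
    simp [A, B]
  exact (h.indep.indepFun_finset A B hAB h.measurable_family).comp
    (show Measurable fun x : A → ℝ => x ⟨Sum.inr (i, 0), by simp [A]⟩ by fun_prop)
    (show Measurable fun y : B → ℝ => y ⟨Sum.inr (i, 1), by simp [B]⟩ *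
      (y ⟨Sum.inl (i, 0), by simp [B]⟩ * y ⟨Sum.inl (i, 1), by simp [B]⟩) ^ 2 by fun_prop)

/-- The Nakagami shapes disappear here: a gamma variable of shape m and rate m/Ω has mean Ω. -/
theorem integrable_and_integral_totalFading (hm : ∀ j, 0 < m j) (hΩ : 0 < Ω) (i : Fin L) :
    Integrable (totalFading N i) P ∧ ∫ w, totalFading N i w ∂P = Ω ^ 2 := by
  have hlaw := fun j => h.law_fading i j
  have hid := fun j => integrable_and_integral_id_gammaMeasure (hm j) (div_pos (hm j) hΩ)
  have hint : ∀ j, Integrable (fun w => N i j w ^ 2) P := fun j => by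
    have := (hid j).1
    rw [← (hlaw j).map_eq] at this
    exact this.comp_aemeasurable (hlaw j).aemeasurable
  have hval : ∀ j, ∫ w, N i j w ^ 2 ∂P = Ω := fun j => by
    have h1 := (hid j).2
    rw [← (hlaw j).map_eq, integral_map (hlaw j).aemeasurable (by fun_prop)] at h1
    have := (hm j).ne'
    rw [h1]
    field_simp
  have hind : IndepFun (fun w => N i 0 w ^ 2) (fun w => N i 1 w ^ 2) P :=
    (h.indep.indepFun (i := Sum.inl (i, 0)) (j := Sum.inl (i, 1)) (by simp)).comp
      (measurable_id.pow_const 2) (measurable_id.pow_const 2)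
  have heq : totalFading N i = fun w => N i 0 w ^ 2 * N i 1 w ^ 2 := by
    ext w; simp [totalFading, mul_pow]
  rw [heq]
  refine ⟨hind.integrable_mul (hint 0) (hint 1), ?_⟩
  rw [hind.integral_fun_mul_eq_mul_integral (hint 0).aestronglyMeasurable
    (hint 1).aestronglyMeasurable, hval, hval, sq]

theorem outputSNR_nonneg_ae {sel : W → Fin L}
    (hsel : IsShadowingSelection P S sel) : ∀ᵐ w ∂P, 0 ≤ outputSNR N S sel w := by
  filter_upwards [hsel.outputSNR_ae_eq_mul, h.ae_shadowing_pos] with w hw hS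
  rw [hw]
  exact mul_nonneg (sq_nonneg _) (mul_pos (hS _ 0) (hS _ 1)).le

variable [IsProbabilityMeasure P]

theorem iIndepFun_totalShadowing : iIndepFun (fun i => totalShadowing S i) P :=
  (iIndepFun_curry h.measurable_shadowing h.iIndepFun_shadowing).comp
    (fun _ x => x 0 * x 1) fun _ => by fun_prop

theorem map_mul_absolutelyContinuous (i : Fin L) :
    P.map (fun w => totalFading N i w * totalShadowing S i w) ≪ volume := by
  have hm1 := h.measurable_totalFading i
  have hm2 := h.measurable_shadowing i 1
  have := UAVSelection.map_mul_absolutelyContinuous (h.measurable_shadowing i 0) (by fun_prop)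
    (h.indepFun_shadowing_mul i)
    (by rw [(h.law_shadowing i 0).map_eq]; exact invGammaMeasure_absolutelyContinuous _ _) (by
      filter_upwards [h.ae_shadowing_pos, h.ae_fading_ne_zero] with w h1 h2
      exact mul_ne_zero (h1 i 1).ne' (pow_ne_zero _ (mul_ne_zero (h2 i 0) (h2 i 1))))
  convert! this using 3 with w
  simp only [totalShadowing]
  ring

theorem ae_totalShadowing_ne : ∀ᵐ w ∂P, ∀ i j, i ≠ j →
    totalShadowing S i w ≠ totalShadowing S j w := by
  refine ae_all_iff.2 fun i => ae_all_iff.2 fun j => ?_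
  by_cases hij : i = j
  · exact ae_of_all _ fun w hne => absurd hij hne
  have hac : P.map (totalShadowing S j) ≪ volume :=
    UAVSelection.map_mul_absolutelyContinuous (h.measurable_shadowing j 0)
      (h.measurable_shadowing j 1)
      (h.iIndepFun_shadowing.indepFun (i := (j, 0)) (j := (j, 1)) (by simp))
      (by rw [(h.law_shadowing j 0).map_eq]; exact invGammaMeasure_absolutelyContinuous _ _)
      (by filter_upwards [h.ae_shadowing_pos] with w hw using (hw j 1).ne')
  filter_upwards [ae_ne_of_indepFun (h.measurable_totalShadowing i).aemeasurable
    (h.measurable_totalShadowing j).aemeasurable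
    (h.iIndepFun_totalShadowing.indepFun hij) hac] with w hw _ using hw

end Basic

variable [IsProbabilityMeasure P]

/-- The total shadowing of the `i`-th UAV on the event that it is the largest one. -/
theorem integrable_and_integral_indicator_totalShadowing {n k : ℕ}
    {N S : Fin (n + 1) → Fin 2 → W → ℝ} (h : IsDoubleShadowing P (n + 1) m Ω α γ N S)
    (hα' : α 1 = α 0 + 1 / 2) (hk3 : 3 ≤ k) (hk : (k : ℝ) = 2 * α 0) (hγ : ∀ j, 0 < γ j)
    (i : Fin (n + 1)) :
    Integrable ({w | ∀ j, totalShadowing S j w ≤ totalShadowing S i w}.indicator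
      (totalShadowing S i)) P ∧
    ∫ w, {w | ∀ j, totalShadowing S j w ≤ totalShadowing S i w}.indicator
      (totalShadowing S i) w ∂P =
      γ 0 * γ 1 * ∫ u, 4 / u ^ 2 * (gammaMeasure k 1).real (Ici u) ^ n ∂gammaMeasure k 1 := by
  have hk0 : (0 : ℝ) < k := by exact_mod_cast (by omega : 0 < k)
  have hα0 : 0 < α 0 := by linarith
  have hγγ : 0 < γ 0 * γ 1 := mul_pos (hγ 0) (hγ 1)
  have := isProbabilityMeasure_gammaMeasure hk0 one_pos
  -- The gamma variables U of the duplication step: Iᵢ = 4γ₁γ₂/Jᵢ², so Iᵢ is largest exactly when Jᵢ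
  -- is smallest.
  let J : Fin (n + 1) → W → ℝ := fun i w => 2 * √(γ 0 * γ 1 / totalShadowing S i w)
  have hJlaw : ∀ i, HasLaw (J i) (gammaMeasure k 1) P := fun i => by
    have h1 := h.law_shadowing i 1
    rw [hα'] at h1
    rw [hk]
    exact hasLaw_sqrt_div_mul hα0 (hγ 0) (hγ 1) (h.law_shadowing i 0) h1
      (h.iIndepFun_shadowing.indepFun (i := (i, 0)) (j := (i, 1)) (by simp))
  have hJind : iIndepFun J P := h.iIndepFun_totalShadowing.comp
    (fun _ x => 2 * √(γ 0 * γ 1 / x)) fun _ => by fun_prop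
  have hJmap : P.map (fun w i => J i w) = Measure.pi fun _ => gammaMeasure k 1 := by
    rw [(iIndepFun_iff_map_fun_eq_pi_map fun i => (hJlaw i).aemeasurable).1 hJind]
    simp_rw [fun i => (hJlaw i).map_eq]
  have hJm : AEMeasurable (fun w i => J i w) P :=
    aemeasurable_pi_lambda _ fun i => (hJlaw i).aemeasurable
  have hpi := integrable_and_integral_pi_indicator_forall_le (gammaMeasure k 1) i
    ((integrable_inv_sq_gammaMeasure hk3).const_mul (γ 0 * γ 1))
  rw [← hJmap] at hpi
  have hae : {w | ∀ j, totalShadowing S j w ≤ totalShadowing S i w}.indicator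
      (totalShadowing S i) =ᵐ[P] fun w => {x : Fin (n + 1) → ℝ | ∀ j, x i ≤ x j}.indicator
        (fun x => γ 0 * γ 1 * (4 / x i ^ 2)) (fun i => J i w) := by
    filter_upwards [h.ae_shadowing_pos] with w hw
    have hpos : ∀ j, 0 < totalShadowing S j w := fun j => mul_pos (hw j 0) (hw j 1)
    have hiff : ∀ j, totalShadowing S j w ≤ totalShadowing S i w ↔ J i w ≤ J j w := fun j => by
      simp only [J]
      rw [mul_le_mul_iff_right₀ two_pos, Real.sqrt_le_sqrt_iff (div_pos hγγ (hpos j)).le,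
        div_le_div_iff_of_pos_left hγγ (hpos i) (hpos j)]
    have hval : γ 0 * γ 1 * (4 / J i w ^ 2) = totalShadowing S i w := by
      have := hpos i
      have h0 := (hγ 0).ne'
      have h1 := (hγ 1).ne'
      simp only [J]
      rw [mul_pow, Real.sq_sqrt (div_pos hγγ (hpos i)).le]
      field_simp
      norm_num
    simp only [indicator, mem_ofPred_eq, hiff, hval]
  have hint := hpi.1.comp_aemeasurable hJm
  refine ⟨(integrable_congr hae).2 hint, ?_⟩
  rw [integral_congr_ae hae, ← integral_map hJm hpi.1.aestronglyMeasurable, hpi.2,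
    ← integral_const_mul]
  simp only [mul_assoc]

/-! ### Density and mean of the output SNR -/

section Output

variable (h : IsDoubleShadowing P L m Ω α γ N S) {sel : W → Fin L}
  (hsel : IsShadowingSelection P S sel)
include h hsel

/-- Outside the null event of a tie, only the selected index contributes. This removes `sel` from
the computation of the mean. -/
theorem outputSNR_ae_eq_sum :
    outputSNR N S sel =ᵐ[P] fun w => ∑ i, totalFading N i w *
      {w | ∀ j, totalShadowing S j w ≤ totalShadowing S i w}.indicator (totalShadowing S i) w := by
  filter_upwards [hsel.outputSNR_ae_eq_mul, hsel.maximal, h.ae_totalShadowing_ne]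
    with w hw hmax hne
  rw [hw, Finset.sum_eq_single (sel w)]
  · rw [indicator_of_mem (by exact hmax)]
  · intro i _ hi
    rw [indicator_of_notMem, mul_zero]
    exact fun hmem => hne i (sel w) hi (le_antisymm (hmax i) (hmem (sel w)))
  · simp

/-- Whatever the selection rule, the output is almost surely one of finitely many products, and
almost surely none of these falls in a given null set. -/
theorem hasPDF_outputSNR : HasPDF (outputSNR N S sel) P volume := by
  have hm : AEMeasurable (outputSNR N S sel) P := by
    refine AEMeasurable.congr ?_ (h.outputSNR_ae_eq_sum hsel).symm
    exact (Finset.measurable_sum _ fun i _ => (h.measurable_totalFading i).mul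
      ((h.measurable_totalShadowing i).indicator
        (h.measurableSet_largest i))).aemeasurable
  rw [Real.hasPDF_iff_of_aemeasurable hm]
  refine Measure.AbsolutelyContinuous.mk fun s hs h0 => ?_
  rw [Measure.map_apply_of_aemeasurable hm hs]
  have hnot : ∀ᵐ w ∂P, ∀ i, totalFading N i w * totalShadowing S i w ∉ s := by
    refine ae_all_iff.2 fun i => ?_
    have := h.map_mul_absolutelyContinuous i h0
    have hm1 := h.measurable_totalFading i
    have hm2 := h.measurable_totalShadowing i
    rw [Measure.map_apply (by fun_prop) hs] at this
    exact measure_eq_zero_iff_ae_notMem.1 this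
  refine measure_eq_zero_iff_ae_notMem.2 ?_
  filter_upwards [hnot, hsel.outputSNR_ae_eq_mul] with w hw hX
  rw [mem_preimage, hX]
  exact hw _

end Output

theorem integrable_and_integral_outputSNR (h : IsDoubleShadowing P L m Ω α γ N S)
    {sel : W → Fin L} (hsel : IsShadowingSelection P S sel) (hL : 1 ≤ L) (hm : ∀ j, 0 < m j)
    (hΩ : 0 < Ω) (hα : 1 < α 0) (hα' : α 1 = α 0 + 1 / 2) {k : ℕ} (hk : (k : ℝ) = 2 * α 0)
    (hγ : ∀ j, 0 < γ j) :
    Integrable (outputSNR N S sel) P ∧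
      ∫ w, outputSNR N S sel w ∂P = closedFormASNR L k α (Ω ^ 2 * (γ 0 * γ 1)) := by
  obtain ⟨n, rfl⟩ : ∃ n, L = n + 1 := ⟨L - 1, by omega⟩
  -- α₁ > 1 gives k > 2, hence k ≥ 3 because k is an integer; this makes 1/u² integrable.
  have hk3 : 3 ≤ k := by
    have : (2 : ℝ) < k := by linarith
    exact_mod_cast this
  have hG := h.integrable_and_integral_indicator_totalShadowing hα' hk3 hk hγ
  have hF := h.integrable_and_integral_totalFading hm hΩ
  have hind : ∀ i, IndepFun (totalFading N i)
      ({w | ∀ j, totalShadowing S j w ≤ totalShadowing S i w}.indicator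
        (totalShadowing S i)) P := fun i => by
    have hmeas : MeasurableSet {x : Fin (n + 1) → Fin 2 → ℝ | ∀ j, x j 0 * x j 1 ≤
        x i 0 * x i 1} := by
      simp only [ofPred_forall]
      exact MeasurableSet.iInter fun j => measurableSet_le (by fun_prop) (by fun_prop)
    exact (h.indepFun_totalFading_shadowing i).comp measurable_id
      (Measurable.indicator (f := fun x => x i 0 * x i 1) (by fun_prop) hmeas)
  have hprod : ∀ i, Integrable (fun w => totalFading N i w *
      {w | ∀ j, totalShadowing S j w ≤ totalShadowing S i w}.indicator (totalShadowing S i) w) P :=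
    fun i => (hind i).integrable_mul (hF i).1 (hG i).1
  have hae := h.outputSNR_ae_eq_sum hsel
  refine ⟨(integrable_congr hae).2 (integrable_finsetSum _ fun i _ => hprod i), ?_⟩
  rw [integral_congr_ae hae, integral_finsetSum _ fun i _ => hprod i,
    closedFormASNR_eq_integral hk3 hk hα']
  simp_rw [fun i => (hind i).integral_fun_mul_eq_mul_integral (hF i).1.aestronglyMeasurable
    (hG i).1.aestronglyMeasurable, fun i => (hF i).2, fun i => (hG i).2]
  simp only [Finset.sum_const, Finset.card_univ, Fintype.card_fin, nsmul_eq_mul]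
  ring

theorem averageSNR_outputSNR (h : IsDoubleShadowing P L m Ω α γ N S)
    {sel : W → Fin L} (hsel : IsShadowingSelection P S sel) (hL : 1 ≤ L) (hm : ∀ j, 0 < m j)
    (hΩ : 0 < Ω) (hα : 1 < α 0) (hα' : α 1 = α 0 + 1 / 2) {k : ℕ} (hk : (k : ℝ) = 2 * α 0)
    (hγ : ∀ j, 0 < γ j) :
    averageSNR P (outputSNR N S sel) = closedFormASNR L k α (Ω ^ 2 * (γ 0 * γ 1)) := by
  have := h.hasPDF_outputSNR hsel
  rw [averageSNR_eq_integral (h.outputSNR_nonneg_ae hsel),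
    (h.integrable_and_integral_outputSNR hsel hL hm hΩ hα hα' hk hγ).2]

end IsDoubleShadowing

end UAVSelection

theorem mainTheorem8 {W : Type*} [MeasurableSpace W] (P : Measure W) [IsProbabilityMeasure P]
    (L : ℕ) (hL : 1 ≤ L) (m : Fin 2 → ℝ) (hm : ∀ j, 0 < m j) (Ω : ℝ) (hΩ : 0 < Ω)
    (α : Fin 2 → ℝ) (hα : ∀ j, 1 < α j) (hα' : α 1 = α 0 + 1 / 2)
    (k : ℕ) (hk : (k : ℝ) = 2 * α 0)
    (γ : Fin 2 → ℝ) (hγ : ∀ j, 0 < γ j)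
    (N S : Fin L → Fin 2 → W → ℝ) (hNS : UAVSelection.IsDoubleShadowing P L m Ω α γ N S)
    (sel : W → Fin L) (hsel : UAVSelection.IsShadowingSelection P S sel) :
    HasPDF (UAVSelection.outputSNR N S sel) P volume ∧
    Integrable (UAVSelection.outputSNR N S sel) P ∧
    IntegrableOn (fun x => x * (pdf (UAVSelection.outputSNR N S sel) P volume x).toReal)
      (Ioi (0 : ℝ)) ∧
    UAVSelection.averageSNR P (UAVSelection.outputSNR N S sel)
      = UAVSelection.closedFormASNR L k α (Ω ^ 2 * (γ 0 * γ 1)) ∧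
    P[UAVSelection.outputSNR N S sel]
      = UAVSelection.closedFormASNR L k α (Ω ^ 2 * (γ 0 * γ 1)) ∧
    ∀ (W' : Type*) [MeasurableSpace W'] (P' : Measure W') [IsProbabilityMeasure P']
      (m' : Fin 2 → ℝ) (_ : ∀ j, 0 < m' j) (N' S' : Fin L → Fin 2 → W' → ℝ)
      (_ : UAVSelection.IsDoubleShadowing P' L m' Ω α γ N' S')
      (sel' : W' → Fin L) (_ : UAVSelection.IsShadowingSelection P' S' sel'),
      UAVSelection.averageSNR P' (UAVSelection.outputSNR N' S' sel')
        = UAVSelection.averageSNR P (UAVSelection.outputSNR N S sel) := by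
  have hpdf := hNS.hasPDF_outputSNR hsel
  have hE := hNS.integrable_and_integral_outputSNR hsel hL hm hΩ (hα 0) hα' hk hγ
  have hA := hNS.averageSNR_outputSNR hsel hL hm hΩ (hα 0) hα' hk hγ
  refine ⟨hpdf, hE.1, ?_, hA, hE.2, fun W' _ P' _ m' hm' N' S' hNS' sel' hsel' => ?_⟩
  · have := (pdf.integrable_pdf_smul_iff (X := UAVSelection.outputSNR N S sel)
      (f := fun x : ℝ => x) (by fun_prop : AEStronglyMeasurable _ volume)).2 hE.1
    simpa only [smul_eq_mul, mul_comm] using this.integrableOn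
  -- Both averages equal the same closed form, in which the Nakagami shapes do not occur.
  · rw [hA, hNS'.averageSNR_outputSNR hsel' hL hm' hΩ (hα 0) hα' hk hγ]
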